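/- For $n\ge 1$ let $\mathcal{P}_n(\mathbb{C})\subseteq \mathbb{C}^{n^3}$ be the set of structure constants $(c_{ij}^k)$ of bilinear products $e_i\cdot e_j=\sum_k c_{ij}^k e_k$ on $\mathbb{C}^n$ that are pre-Lie, i.e. $(x\cdot y)\cdot z-x\cdot(y\cdot z)=(y\cdot x)\cdot z-y\cdot(x\cdot z)$ for all $x,y,z$. The group $GL_n(\mathbb{C})$ acts by $(g\circ\mu)(x,y)=g(\mu(g^{-1}x,g^{-1}y))$; let $O(\mu)$ be the orbit of $\mu$ and $\overline{O(\mu)}$ its Zariski closure in $\mathcal{P}_n(\mathbb{C})$. We say that $\lambda$ degenerates properly to $\mu$ if $\mu\in\overline{O(\lambda)}\setminus O(\lambda)$. For $n=2$ consider the following pre-Lie algebras with basis $e_1,e_2$ (products not listed are zero): - $A_1$: zero product; - $A_2$: $e_1\cdot e_1=e_1$; - $A_3$: $e_1\cdot e_1=e_1$, $e_2\cdot e_2=e_2$; - $A_4$: $e_1\cdot e_2=e_2\cdot e_1=e_1$, $e_2\cdot e_2=e_2$; - $A_5$: $e_2\cdot e_2=e_1$; - $B_1(\alpha)$, $\alpha\in\mathbb{C}$: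 $e_2\cdot e_1=-e_1$, $e_2\cdot e_2=\alpha e_2$; - $B_2(\beta)$, $\beta\in\mathbb{C}\setminus\{0\}$: $e_1\cdot e_2=\beta e_1$, $e_2\cdot e_1=(\beta-1)e_1$, $e_2\cdot e_2=\beta e_2$; - $B_3$: $e_2\cdot e_1=-e_1$, $e_2\cdot e_2=e_1-e_2$; - $B_4$: $e_1\cdot e_1=e_2$, $e_2\cdot e_1=-e_1$, $e_2\cdot e_2=-2e_2$; - $B_5$: $e_1\cdot e_2=e_1$, $e_2\cdot e_2=e_1+e_2$. Theorem. For each algebra $A$ of this list, the orbit closure $\overline{O(A)}$ in $\mathcal{P}_2(\mathbb{C})$ is the union of $O(A)$ and of the orbits of the algebras listed next to $A$ below; and, among the algebras of the list above, $A$ degenerates properly exactly to those listed next to it: - $A_3$: $A_2,\ A_4,\ A_5,\ A_1$; - $B_4$: $B_1(-2),\ B_2(-1),\ A_5,\ A_1$; - $A_2$: $A_5,\ A_1$; - $A_4$: $A_5,\ A_1$; - $B_1(\alpha)$, $\alpha\neq -1$: $A_5,\ A_1$; - $B_2(\beta)$, $\beta\neq 0,1$: $A_5,\ A_1$; - $B_3$: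 $A_5,\ B_1(-1),\ A_1$; - $B_5$: $A_5,\ B_2(1),\ A_1$; - $A_5$: $A_1$; - $B_1(-1)$: $A_1$; - $B_2(1)$: $A_1$; - $A_1$: none. -/

import Mathlib

noncomputable section

namespace PreLieDegeneration

open Matrix

/-- Structure constants of a bilinear product on `Kⁿ` with its standard basis:
`c (i, j, k)` is the coefficient of `e_k` in `e_i · e_j`. These are the points of the affine
space `K^{n³}`. -/
abbrev StructureConstants (n : ℕ) (K : Type*) : Type _ := Fin n × Fin n × Fin n → K

section General

variable {n : ℕ} {K : Type*} [Field K]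

/-- The product `x · y` on `Kⁿ` with structure constants `c`. -/
def mul (c : StructureConstants n K) (x y : Fin n → K) : Fin n → K :=
  fun k => ∑ i, ∑ j, x i * y j * c (i, j, k)

/-- The product is pre-Lie (left-symmetric):
`(x · y) · z - x · (y · z) = (y · x) · z - y · (x · z)` for all `x, y, z`. -/
def IsPreLie (c : StructureConstants n K) : Prop :=
  ∀ x y z : Fin n → K,
    mul c (mul c x y) z - mul c x (mul c y z) = mul c (mul c y x) z - mul c y (mul c x z)

variable (n K) in
/-- The variety `𝒫ₙ(K)` of pre-Lie algebra structures on `Kⁿ`. -/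
def preLieVariety : Set (StructureConstants n K) := {c | IsPreLie c}

/-- The action of `GLₙ(K)` on structures by base change: `(g ∘ c)(x, y) = g (c (g⁻¹ x, g⁻¹ y))`,
recorded through its values on the standard basis. -/
def act (g : GL (Fin n) K) (c : StructureConstants n K) : StructureConstants n K :=
  fun t =>
    ((g : Matrix (Fin n) (Fin n) K) *ᵥ
      mul c (((g⁻¹ : GL (Fin n) K) : Matrix (Fin n) (Fin n) K) *ᵥ Pi.single t.1 1)
        (((g⁻¹ : GL (Fin n) K) : Matrix (Fin n) (Fin n) K) *ᵥ Pi.single t.2.1 1)) t.2.2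

/-- The orbit `O(c)` under the action of `GLₙ(K)`. -/
def orbit (c : StructureConstants n K) : Set (StructureConstants n K) :=
  Set.range fun g : GL (Fin n) K => act g c

/-- The closure of a set of structure constants in the Zariski topology of the affine space:
the common zeros of all polynomials that vanish on the set. -/
def zariskiClosure (S : Set (StructureConstants n K)) : Set (StructureConstants n K) :=
  MvPolynomial.zeroLocus K (MvPolynomial.vanishingIdeal K S)

/-- The Zariski closure of the orbit `O(c)` inside the variety `𝒫ₙ(K)`. -/
def orbitClosure (c : StructureConstants n K) : Set (StructureConstants n K) :=
  preLieVariety n K ∩ zariskiClosure (orbit c)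

/-- `c` degenerates properly to `d`: `d` lies in the orbit closure of `c`, but not in the
orbit of `c`. -/
def ProperlyDegenerates (c d : StructureConstants n K) : Prop :=
  d ∈ orbitClosure c \ orbit c

end General

/-- The labels of the `2`-dimensional complex pre-Lie algebras in the classification. -/
inductive Label : Type
  | A1 | A2 | A3 | A4 | A5
  | B1 (α : ℂ)
  | B2 (β : ℂ) (hβ : β ≠ 0)
  | B3 | B4 | B5

/-- The structure on `ℂ²` with `e₁·e₁ = p`, `e₁·e₂ = q`, `e₂·e₁ = r`, `e₂·e₂ = s`. -/
def ofProducts (p q r s : Fin 2 → ℂ) : StructureConstants 2 ℂ :=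
  fun t => (![![p, q], ![r, s]] : Fin 2 → Fin 2 → Fin 2 → ℂ) t.1 t.2.1 t.2.2

/-- The structure on `ℂ²` with a given label; `![a, b]` stands for `a e₁ + b e₂`, and the four
arguments are `e₁·e₁`, `e₁·e₂`, `e₂·e₁`, `e₂·e₂`. -/
def law : Label → StructureConstants 2 ℂ
  | .A1 => ofProducts ![0, 0] ![0, 0] ![0, 0] ![0, 0]
  | .A2 => ofProducts ![1, 0] ![0, 0] ![0, 0] ![0, 0]
  | .A3 => ofProducts ![1, 0] ![0, 0] ![0, 0] ![0, 1]
  | .A4 => ofProducts ![0, 0] ![1, 0] ![1, 0] ![0, 1]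
  | .A5 => ofProducts ![0, 0] ![0, 0] ![0, 0] ![1, 0]
  | .B1 α => ofProducts ![0, 0] ![0, 0] ![-1, 0] ![0, α]
  | .B2 β _ => ofProducts ![0, 0] ![β, 0] ![β - 1, 0] ![0, β]
  | .B3 => ofProducts ![0, 0] ![0, 0] ![-1, 0] ![1, -1]
  | .B4 => ofProducts ![0, 1] ![0, 0] ![-1, 0] ![0, -2]
  | .B5 => ofProducts ![0, 0] ![1, 0] ![0, 0] ![1, 1]

/-- One row of the classification of orbit closures: `S` is the exact list of algebras in the
orbit closure of `a` other than `a` itself. That is, the orbit closure of `a` in `𝒫₂(ℂ)` is the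
union of the orbit of `a` and of the orbits of the members of `S`, and, among the labelled
algebras, `a` degenerates properly exactly to the members of `S`. -/
def DegeneratesExactlyTo (a : Label) (S : Set Label) : Prop :=
  (orbitClosure (law a) = orbit (law a) ∪ ⋃ b ∈ S, orbit (law b)) ∧
    ∀ b : Label, ProperlyDegenerates (law a) (law b) ↔ b ∈ S

end PreLieDegeneration

end

/-!
The orbit closure of an algebra `A` of the list is bounded from above by invariant polynomial
equations, from below by explicit degenerations, and the two bounds are matched by the
classification of the two-dimensional pre-Lie structures.

*Upper bound.* A `GL₂`-invariant system of polynomial equations that holds for `A` holds on the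
Zariski closure of its orbit. The invariants used are the linear forms `x ↦ tr L_x` and
`x ↦ tr R_x` and the characteristic polynomials of the left and right multiplications `L_x`, `R_x`,
together with commutativity and the condition that every `x · x` be parallel to `x`. For each `A`
a few such equations (`closureEquations`) exclude all algebras of the list except `A` and those next
to it (`eq_or_mem_properDegenerations`). As the latter have stricter equations, which fail for `A`,
the same lemma shows that they lie outside the orbit of `A`.

*Lower bound.* A polynomial that vanishes on an orbit vanishes on all limits of continuous curves
in it, so that a degeneration is given by bases `f₁ t`, `f₂ t` in which the multiplication table has
a limit at `t = 0`. Scaling degenerates everything to `A₁`, and an algebra with some `x · x` not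
parallel to `x` degenerates to `A₅`; the remaining degenerations are written down one by one
(`mem_zariskiClosure_of_mem_properDegenerations`). Zariski closures of orbits are `GL₂`-stable, so
whole orbits lie in the closure.

*Classification.* Every pre-Lie structure on `ℂ²` lies in the orbit of an algebra of the list
(`exists_law_mem_orbit`). In the noncommutative case the identity `[L_x, L_y] = L_[x, y]` in a basis
with `[e₁, e₂] = e₁` makes `L_{e₁}` nilpotent; in the commutative case the algebra is associative
and is either zero or generated by one element.
-/

namespace PreLieDegeneration

open Matrix

section General

variable {n : ℕ} {K : Type*} [Field K]

/-! ### Structure constants as bilinear products -/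

/-- The matrix of left multiplication `L_x : y ↦ x · y`. -/
def leftMul (c : StructureConstants n K) (x : Fin n → K) : Matrix (Fin n) (Fin n) K :=
  Matrix.of fun k j => ∑ i, x i * c (i, j, k)

/-- The matrix of right multiplication `R_x : y ↦ y · x`. -/
def rightMul (c : StructureConstants n K) (x : Fin n → K) : Matrix (Fin n) (Fin n) K :=
  Matrix.of fun k i => ∑ j, x j * c (i, j, k)

theorem leftMul_mulVec (c : StructureConstants n K) (x y : Fin n → K) :
    leftMul c x *ᵥ y = mul c x y := by
  ext k
  simp only [leftMul, mul, mulVec, dotProduct, of_apply, Finset.sum_mul]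
  rw [Finset.sum_comm]
  exact Finset.sum_congr rfl fun i _ => Finset.sum_congr rfl fun j _ => by ring

theorem rightMul_mulVec (c : StructureConstants n K) (x y : Fin n → K) :
    rightMul c y *ᵥ x = mul c x y := by
  ext k
  simp only [rightMul, mul, mulVec, dotProduct, of_apply, Finset.sum_mul]
  exact Finset.sum_congr rfl fun i _ => Finset.sum_congr rfl fun j _ => by ring

/-- The product with structure constants `c` as a bilinear map. -/
def mulBilin (c : StructureConstants n K) :
    (Fin n → K) →ₗ[K] (Fin n → K) →ₗ[K] (Fin n → K) :=
  LinearMap.mk₂ K (mul c)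
    (fun x y z => by simp only [← rightMul_mulVec, mulVec_add])
    (fun a x y => by simp only [← rightMul_mulVec, mulVec_smul])
    (fun x y z => by simp only [← leftMul_mulVec, mulVec_add])
    (fun a x y => by simp only [← leftMul_mulVec, mulVec_smul])

@[simp]
theorem mulBilin_apply (c : StructureConstants n K) (x y : Fin n → K) :
    mulBilin c x y = mul c x y := rfl

@[simp]
theorem mul_single_single (c : StructureConstants n K) (i j : Fin n) :
    mul c (Pi.single i 1) (Pi.single j 1) = fun k => c (i, j, k) := by
  ext k
  simp [mul, Pi.single_apply]

theorem mul_injective {c d : StructureConstants n K} (h : ∀ x y, mul c x y = mul d x y) :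
    c = d := by
  ext ⟨i, j, k⟩
  simpa using congrFun (h (Pi.single i 1) (Pi.single j 1)) k

/-! ### The action of the general linear group -/

theorem mul_act (g : GL (Fin n) K) (c : StructureConstants n K) (x y : Fin n → K) :
    mul (act g c) x y =
      (g : Matrix (Fin n) (Fin n) K) *ᵥ
        mul c (((g⁻¹ : GL (Fin n) K) : Matrix (Fin n) (Fin n) K) *ᵥ x)
          (((g⁻¹ : GL (Fin n) K) : Matrix (Fin n) (Fin n) K) *ᵥ y) := by
  have h : mulBilin (act g c) =
      ((mulBilin c).compl₁₂ ((g⁻¹ : GL (Fin n) K) : Matrix (Fin n) (Fin n) K).mulVecLin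
        ((g⁻¹ : GL (Fin n) K) : Matrix (Fin n) (Fin n) K).mulVecLin).compr₂
          (g : Matrix (Fin n) (Fin n) K).mulVecLin := by
    refine LinearMap.pi_ext' fun i => LinearMap.ext_ring (LinearMap.pi_ext' fun j =>
      LinearMap.ext_ring ?_)
    simp only [LinearMap.comp_apply, LinearMap.single_apply, LinearMap.compr₂_apply,
      LinearMap.compl₁₂_apply, mulBilin_apply, mul_single_single, mulVecLin_apply]
    rfl
  exact LinearMap.congr_fun₂ h x y

theorem coe_mulVec_inv_mulVec (g : GL (Fin n) K) (x : Fin n → K) :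
    (g : Matrix (Fin n) (Fin n) K) *ᵥ
      (((g⁻¹ : GL (Fin n) K) : Matrix (Fin n) (Fin n) K) *ᵥ x) = x := by
  rw [mulVec_mulVec, ← Units.val_mul, mul_inv_cancel, Units.val_one, one_mulVec]

theorem coe_inv_mulVec_mulVec (g : GL (Fin n) K) (x : Fin n → K) :
    ((g⁻¹ : GL (Fin n) K) : Matrix (Fin n) (Fin n) K) *ᵥ
      ((g : Matrix (Fin n) (Fin n) K) *ᵥ x) = x := by
  simp

theorem act_one (c : StructureConstants n K) : act 1 c = c :=
  mul_injective fun x y => by simp [mul_act]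

theorem act_act (g h : GL (Fin n) K) (c : StructureConstants n K) :
    act g (act h c) = act (g * h) c :=
  mul_injective fun x y => by simp [mul_act, mulVec_mulVec]

theorem leftMul_act (g : GL (Fin n) K) (c : StructureConstants n K) (x : Fin n → K) :
    leftMul (act g c) x =
      g * leftMul c (((g⁻¹ : GL (Fin n) K) : Matrix (Fin n) (Fin n) K) *ᵥ x) *
        ((g⁻¹ : GL (Fin n) K) : Matrix (Fin n) (Fin n) K) := by
  refine ext_of_mulVec_single fun i => ?_
  rw [leftMul_mulVec, mul_act, ← leftMul_mulVec, mulVec_mulVec, mulVec_mulVec, Matrix.mul_assoc]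

theorem rightMul_act (g : GL (Fin n) K) (c : StructureConstants n K) (x : Fin n → K) :
    rightMul (act g c) x =
      g * rightMul c (((g⁻¹ : GL (Fin n) K) : Matrix (Fin n) (Fin n) K) *ᵥ x) *
        ((g⁻¹ : GL (Fin n) K) : Matrix (Fin n) (Fin n) K) := by
  refine ext_of_mulVec_single fun i => ?_
  rw [rightMul_mulVec, mul_act, ← rightMul_mulVec, mulVec_mulVec, mulVec_mulVec,
    Matrix.mul_assoc]

theorem self_mem_orbit (c : StructureConstants n K) : c ∈ orbit c := ⟨1, act_one c⟩

theorem orbit_symm {c d : StructureConstants n K} (h : d ∈ orbit c) : c ∈ orbit d := by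
  obtain ⟨g, rfl⟩ := h
  exact ⟨g⁻¹, by simp [act_act, act_one]⟩

theorem orbit_trans {c d e : StructureConstants n K} (h : d ∈ orbit c) (h' : e ∈ orbit d) :
    e ∈ orbit c := by
  obtain ⟨g, rfl⟩ := h
  obtain ⟨g', rfl⟩ := h'
  exact ⟨g' * g, by simp [act_act]⟩

theorem orbit_eq {c d : StructureConstants n K} (h : d ∈ orbit c) : orbit d = orbit c :=
  Set.ext fun _ => ⟨orbit_trans h, orbit_trans (orbit_symm h)⟩

theorem IsPreLie.act {c : StructureConstants n K} (hc : IsPreLie c) (g : GL (Fin n) K) :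
    IsPreLie (act g c) := by
  intro x y z
  simp only [mul_act, coe_inv_mulVec_mulVec, ← mulVec_sub]
  rw [hc]

theorem IsPreLie.of_mem_orbit {c d : StructureConstants n K} (hc : IsPreLie c)
    (hd : d ∈ orbit c) : IsPreLie d := by
  obtain ⟨g, rfl⟩ := hd
  exact hc.act g

/-- Structure constants of `c` in the basis formed by the columns of an invertible matrix `M`
lie in the orbit of `c`; the base change is `M⁻¹`. -/
theorem mem_orbit_of_matrix {c d : StructureConstants n K} (M : Matrix (Fin n) (Fin n) K)
    (hM : M.det ≠ 0)
    (h : ∀ i j, M *ᵥ (fun k => d (i, j, k)) = mul c (M.col i) (M.col j)) : d ∈ orbit c := by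
  refine ⟨(GeneralLinearGroup.mkOfDetNeZero M hM)⁻¹, ?_⟩
  ext ⟨i, j, k⟩
  simp only [act, inv_inv]
  change ((((GeneralLinearGroup.mkOfDetNeZero M hM)⁻¹ : GL (Fin n) K) :
    Matrix (Fin n) (Fin n) K) *ᵥ mul c (M *ᵥ _) (M *ᵥ _)) k = _
  rw [mulVec_single_one, mulVec_single_one, ← h]
  exact congrFun (coe_inv_mulVec_mulVec (GeneralLinearGroup.mkOfDetNeZero M hM) _) k

/-! ### Closed invariant conditions -/

theorem subset_zariskiClosure (S : Set (StructureConstants n K)) : S ⊆ zariskiClosure S :=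
  MvPolynomial.zeroLocus_vanishingIdeal_le S

/-- A function on the space of structure constants given by a polynomial. -/
def IsPolynomial (F : StructureConstants n K → K) : Prop :=
  ∃ p : MvPolynomial (Fin n × Fin n × Fin n) K, ∀ c, MvPolynomial.eval c p = F c

namespace IsPolynomial

variable {F G : StructureConstants n K → K}

theorem const (a : K) : IsPolynomial fun _ : StructureConstants n K => a :=
  ⟨MvPolynomial.C a, by simp⟩

theorem coord (t : Fin n × Fin n × Fin n) : IsPolynomial fun c : StructureConstants n K => c t :=
  ⟨MvPolynomial.X t, by simp⟩

theorem sub (hF : IsPolynomial F) (hG : IsPolynomial G) : IsPolynomial fun c => F c - G c := by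
  obtain ⟨⟨p, hp⟩, q, hq⟩ := hF, hG
  exact ⟨p - q, by simp [hp, hq]⟩

theorem mul (hF : IsPolynomial F) (hG : IsPolynomial G) : IsPolynomial fun c => F c * G c := by
  obtain ⟨⟨p, hp⟩, q, hq⟩ := hF, hG
  exact ⟨p * q, by simp [hp, hq]⟩

theorem sum {ι : Type*} (s : Finset ι) {F : ι → StructureConstants n K → K}
    (hF : ∀ i, IsPolynomial (F i)) : IsPolynomial fun c => ∑ i ∈ s, F i c := by
  choose p hp using hF
  exact ⟨∑ i ∈ s, p i, by simp [hp]⟩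

theorem pow (hF : IsPolynomial F) (m : ℕ) : IsPolynomial fun c => F c ^ m := by
  obtain ⟨p, hp⟩ := hF
  exact ⟨p ^ m, by simp [hp]⟩

theorem mul_apply (x y : Fin n → K) (k : Fin n) :
    IsPolynomial fun c => PreLieDegeneration.mul c x y k :=
  sum _ fun _ => sum _ fun _ => (const _).mul (coord _)

theorem leftMul_apply (x : Fin n → K) (i j : Fin n) : IsPolynomial fun c => leftMul c x i j :=
  sum Finset.univ fun l => (const (x l)).mul (coord (l, j, i))

theorem rightMul_apply (x : Fin n → K) (i j : Fin n) : IsPolynomial fun c => rightMul c x i j :=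
  sum Finset.univ fun l => (const (x l)).mul (coord (j, l, i))

theorem trace {A : StructureConstants n K → Matrix (Fin n) (Fin n) K}
    (hA : ∀ i j, IsPolynomial fun c => A c i j) : IsPolynomial fun c => (A c).trace :=
  sum _ fun i => hA i i

theorem det {A : StructureConstants n K → Matrix (Fin n) (Fin n) K}
    (hA : ∀ i j, IsPolynomial fun c => A c i j) : IsPolynomial fun c => (A c).det := by
  choose p hp using hA
  refine ⟨(Matrix.of p).det, fun c => ?_⟩
  rw [RingHom.map_det]
  congr 1
  ext i j
  simp [hp]

end IsPolynomial

/-- A condition on structure constants that passes from `c` to the Zariski closure of the orbit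
of `c`. -/
def PassesToClosure (P : StructureConstants n K → Prop) : Prop :=
  ∀ c, P c → ∀ d ∈ zariskiClosure (orbit c), P d

namespace PassesToClosure

variable {P Q : StructureConstants n K → Prop}

/-- A `GLₙ`-invariant condition given by polynomial equations passes to orbit closures. -/
theorem of_polynomial {ι : Type*} (F : ι → StructureConstants n K → K)
    (hF : ∀ i, IsPolynomial (F i))
    (hinv : ∀ g c, (∀ i, F i c = 0) → ∀ i, F i (act g c) = 0) :
    PassesToClosure fun c => ∀ i, F i c = 0 := by
  intro c hc d hd i
  obtain ⟨p, hp⟩ := hF i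
  rw [← hp]
  refine MvPolynomial.mem_zeroLocus_iff.1 hd p (MvPolynomial.mem_vanishingIdeal_iff.2 ?_)
  rintro _ ⟨g, rfl⟩
  exact (hp _).trans (hinv g c hc i)

theorem and (hP : PassesToClosure P) (hQ : PassesToClosure Q) :
    PassesToClosure fun c => P c ∧ Q c :=
  fun c hc d hd => ⟨hP c hc.1 d hd, hQ c hc.2 d hd⟩

theorem imp (A : Prop) (hP : PassesToClosure P) : PassesToClosure fun c => A → P c :=
  fun c hc d hd hA => hP c (hc hA) d hd

theorem of_mem_orbit (hP : PassesToClosure P) {c d : StructureConstants n K} (hc : P c)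
    (hd : d ∈ orbit c) : P d :=
  hP c hc d (subset_zariskiClosure _ hd)

end PassesToClosure

end General

/-! ### Invariant conditions in dimension two -/

/-- The linear relation `p · tr L_x = q · tr R_x`, for all `x`. -/
def TraceRelation (p q : ℂ) (c : StructureConstants 2 ℂ) : Prop :=
  ∀ x, p * (leftMul c x).trace - q * (rightMul c x).trace = 0

/-- No left multiplication is invertible. -/
def LeftSingular (c : StructureConstants 2 ℂ) : Prop :=
  ∀ x, (leftMul c x).det = 0

/-- No right multiplication is invertible. -/
def RightSingular (c : StructureConstants 2 ℂ) : Prop :=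
  ∀ x, (rightMul c x).det = 0

/-- The characteristic polynomial of each left multiplication has a double root. -/
def LeftDoubleRoot (c : StructureConstants 2 ℂ) : Prop :=
  ∀ x, (leftMul c x).trace ^ 2 - 4 * (leftMul c x).det = 0

/-- The characteristic polynomial of each right multiplication has a double root. -/
def RightDoubleRoot (c : StructureConstants 2 ℂ) : Prop :=
  ∀ x, (rightMul c x).trace ^ 2 - 4 * (rightMul c x).det = 0

/-- Each square `x · x` is parallel to `x`. -/
def SquaresParallel (c : StructureConstants 2 ℂ) : Prop :=
  ∀ x, x 0 * mul c x x 1 - x 1 * mul c x x 0 = 0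

/-- The product is commutative. -/
def IsCommutative (c : StructureConstants 2 ℂ) : Prop :=
  ∀ x y, mul c x y = mul c y x

theorem TraceRelation.passesToClosure (p q : ℂ) : PassesToClosure (TraceRelation p q) := by
  refine .of_polynomial _ (fun x => ((IsPolynomial.const p).mul (.trace (.leftMul_apply x))).sub
    ((IsPolynomial.const q).mul (.trace (.rightMul_apply x)))) fun g c h x => ?_
  rw [leftMul_act, rightMul_act, trace_units_conj, trace_units_conj]
  exact h _

theorem LeftSingular.passesToClosure : PassesToClosure LeftSingular := by
  refine .of_polynomial _ (fun x => .det (.leftMul_apply x)) fun g c h x => ?_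
  rw [leftMul_act, det_units_conj]
  exact h _

theorem RightSingular.passesToClosure : PassesToClosure RightSingular := by
  refine .of_polynomial _ (fun x => .det (.rightMul_apply x)) fun g c h x => ?_
  rw [rightMul_act, det_units_conj]
  exact h _

theorem LeftDoubleRoot.passesToClosure : PassesToClosure LeftDoubleRoot := by
  refine .of_polynomial _ (fun x => ((IsPolynomial.trace (.leftMul_apply x)).pow 2).sub
    ((IsPolynomial.const 4).mul (.det (.leftMul_apply x)))) fun g c h x => ?_
  rw [leftMul_act, det_units_conj, trace_units_conj]
  exact h _

theorem RightDoubleRoot.passesToClosure : PassesToClosure RightDoubleRoot := by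
  refine .of_polynomial _ (fun x => ((IsPolynomial.trace (.rightMul_apply x)).pow 2).sub
    ((IsPolynomial.const 4).mul (.det (.rightMul_apply x)))) fun g c h x => ?_
  rw [rightMul_act, det_units_conj, trace_units_conj]
  exact h _

theorem mulVec_cross_mulVec (M : Matrix (Fin 2) (Fin 2) ℂ) (x y : Fin 2 → ℂ) :
    (M *ᵥ x) 0 * (M *ᵥ y) 1 - (M *ᵥ x) 1 * (M *ᵥ y) 0 = M.det * (x 0 * y 1 - x 1 * y 0) := by
  simp only [mulVec, dotProduct, Fin.sum_univ_two, det_fin_two]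
  ring

theorem SquaresParallel.passesToClosure : PassesToClosure SquaresParallel := by
  refine .of_polynomial _ (fun x => ((IsPolynomial.const (x 0)).mul (.mul_apply x x 1)).sub
    ((IsPolynomial.const (x 1)).mul (.mul_apply x x 0))) fun g c h x => ?_
  rw [mul_act]
  obtain ⟨y, rfl⟩ : ∃ y, (g : Matrix (Fin 2) (Fin 2) ℂ) *ᵥ y = x :=
    ⟨_, coe_mulVec_inv_mulVec g x⟩
  rw [coe_inv_mulVec_mulVec, mulVec_cross_mulVec, h y, mul_zero]

theorem IsCommutative.passesToClosure : PassesToClosure IsCommutative := by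
  have h := PassesToClosure.of_polynomial
    (fun (t : (Fin 2 → ℂ) × (Fin 2 → ℂ) × Fin 2) c => mul c t.1 t.2.1 t.2.2 - mul c t.2.1 t.1 t.2.2)
    (fun t => .sub (.mul_apply _ _ _) (.mul_apply _ _ _)) (fun g c h t => by
      have h' : ∀ x y, mul c x y = mul c y x := fun x y =>
        funext fun k => sub_eq_zero.1 (h (x, y, k))
      simp only [mul_act]
      rw [h', sub_self])
  intro c hc d hd x y
  exact funext fun k => sub_eq_zero.1 (h c (fun t => sub_eq_zero.2 (by rw [hc])) d hd (x, y, k))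

theorem passesToClosure_eq_zero :
    PassesToClosure fun c : StructureConstants 2 ℂ => ∀ t, c t = 0 := by
  refine .of_polynomial _ (fun t => .coord t) fun g c h t => ?_
  have h0 : c = 0 := funext h
  have hm : ∀ x y, mul c x y = 0 := fun x y => by ext k; simp [mul, h0]
  simp only [act, hm, mulVec_zero, Pi.zero_apply]

/-! ### Equations of the orbit closures -/

theorem leftMul_ofProducts (p q r s x : Fin 2 → ℂ) :
    leftMul (ofProducts p q r s) x =
      !![x 0 * p 0 + x 1 * r 0, x 0 * q 0 + x 1 * s 0;
        x 0 * p 1 + x 1 * r 1, x 0 * q 1 + x 1 * s 1] := by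
  ext i j
  fin_cases i <;> fin_cases j <;> simp [leftMul, ofProducts, Fin.sum_univ_two]

theorem rightMul_ofProducts (p q r s x : Fin 2 → ℂ) :
    rightMul (ofProducts p q r s) x =
      !![x 0 * p 0 + x 1 * q 0, x 0 * r 0 + x 1 * s 0;
        x 0 * p 1 + x 1 * q 1, x 0 * r 1 + x 1 * s 1] := by
  ext i j
  fin_cases i <;> fin_cases j <;> simp [rightMul, ofProducts, Fin.sum_univ_two]

theorem mul_ofProducts (p q r s x y : Fin 2 → ℂ) :
    mul (ofProducts p q r s) x y =
      (x 0 * y 0) • p + (x 0 * y 1) • q + (x 1 * y 0) • r + (x 1 * y 1) • s := by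
  ext k
  simp [mul, ofProducts, Fin.sum_univ_two]
  ring

/-- Invariant polynomial equations that cut the orbit closure of `law a` out of the variety of
pre-Lie structures. -/
def closureEquations : Label → StructureConstants 2 ℂ → Prop
  | .A1, c => ∀ t, c t = 0
  | .A2, c => IsCommutative c ∧ LeftSingular c
  | .A3, c => IsCommutative c
  | .A4, c => IsCommutative c ∧ LeftDoubleRoot c
  | .A5, c => TraceRelation 1 0 c ∧ TraceRelation 0 1 c
  | .B1 α, c => (TraceRelation α (α - 1) c ∧ RightSingular c) ∧ (α = -1 → SquaresParallel c)
  | .B2 β _, c =>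
    (TraceRelation (2 * β) (2 * β - 1) c ∧ RightDoubleRoot c) ∧ (β = 1 → SquaresParallel c)
  | .B3, c => TraceRelation 1 2 c ∧ RightSingular c
  | .B4, c => TraceRelation 2 3 c
  | .B5, c => TraceRelation 2 1 c ∧ RightDoubleRoot c

theorem closureEquations_passesToClosure (a : Label) : PassesToClosure (closureEquations a) := by
  cases a with
  | A1 => exact passesToClosure_eq_zero
  | A2 => exact IsCommutative.passesToClosure.and LeftSingular.passesToClosure
  | A3 => exact IsCommutative.passesToClosure
  | A4 => exact IsCommutative.passesToClosure.and LeftDoubleRoot.passesToClosure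
  | A5 => exact (TraceRelation.passesToClosure 1 0).and (TraceRelation.passesToClosure 0 1)
  | B1 α =>
    exact ((TraceRelation.passesToClosure _ _).and RightSingular.passesToClosure).and
      (SquaresParallel.passesToClosure.imp _)
  | B2 β _ =>
    exact ((TraceRelation.passesToClosure _ _).and
      RightDoubleRoot.passesToClosure).and (SquaresParallel.passesToClosure.imp _)
  | B3 => exact (TraceRelation.passesToClosure _ _).and RightSingular.passesToClosure
  | B4 => exact TraceRelation.passesToClosure _ _
  | B5 => exact (TraceRelation.passesToClosure _ _).and RightDoubleRoot.passesToClosure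

theorem closureEquations_self (a : Label) : closureEquations a (law a) := by
  cases a <;>
  simp [closureEquations, law, IsCommutative, LeftSingular, LeftDoubleRoot, TraceRelation,
    RightSingular, RightDoubleRoot, SquaresParallel, leftMul_ofProducts, rightMul_ofProducts,
    mul_ofProducts, trace_fin_two_of, det_fin_two_of, ofProducts]
  all_goals grind

/-- The algebras to which `law a` degenerates properly. The rows of `B₁` and `B₂` cover their
exceptional parameters `-1` and `1`, for which `A₅` drops out. -/
def properDegenerations : Label → Set Label
  | .A1 => ∅
  | .A2 => {.A5, .A1}
  | .A3 => {.A2, .A4, .A5, .A1}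
  | .A4 => {.A5, .A1}
  | .A5 => {.A1}
  | .B1 α => {b | (α ≠ -1 ∧ b = .A5) ∨ b = .A1}
  | .B2 β _ => {b | (β ≠ 1 ∧ b = .A5) ∨ b = .A1}
  | .B3 => {.A5, .B1 (-1), .A1}
  | .B4 => {.B1 (-2), .B2 (-1) (neg_ne_zero.mpr one_ne_zero), .A5, .A1}
  | .B5 => {.A5, .B2 1 one_ne_zero, .A1}

/-- The equations attached to `a` separate it from all algebras of the list that are not among
`properDegenerations a`: on any other algebra one of them fails
already at `e₁`, `e₂` or `e₁ + e₂`. -/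
theorem eq_or_mem_properDegenerations {a b : Label} (h : closureEquations a (law b)) :
    b = a ∨ b ∈ properDegenerations a := by
  cases a with
  | A1 => cases b <;> simp [closureEquations, law, ofProducts] at h ⊢; grind
  | A2 =>
    have h1 := h.1 ![1, 0] ![0, 1]
    have h2 := h.2 ![1, 1]
    cases b <;>
      simp [properDegenerations, law, mul_ofProducts, leftMul_ofProducts]
        at h1 h2 ⊢
    grind
  | A3 =>
    have h1 := h ![1, 0] ![0, 1]
    cases b <;>
      simp [properDegenerations, law, mul_ofProducts]
        at h1 ⊢
    grind
  | A4 =>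
    have h1 := h.1 ![1, 0] ![0, 1]
    have h2 := h.2 ![1, 0]
    cases b <;>
      simp [properDegenerations, law, mul_ofProducts, leftMul_ofProducts]
        at h1 h2 ⊢
    grind
  | A5 =>
    have h1 := h.1 ![1, 0]
    have h2 := h.2 ![1, 0]
    have h3 := h.1 ![0, 1]
    have h4 := h.2 ![0, 1]
    cases b <;>
      simp [properDegenerations, law, leftMul_ofProducts, rightMul_ofProducts]
        at h1 h2 h3 h4 ⊢ <;>
      grind
  | B1 α =>
    have h1 := h.1.1 ![1, 0]
    have h2 := h.1.1 ![0, 1]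
    have h3 := h.1.2 ![1, 0]
    have h4 := h.1.2 ![0, 1]
    have h5 := fun hα => h.2 hα ![1, 1]
    cases b <;>
      simp [properDegenerations, law, mul_ofProducts, leftMul_ofProducts, rightMul_ofProducts]
        at h1 h2 h3 h4 h5 ⊢ <;>
      grind
  | B2 β hβ =>
    have h1 := h.1.1 ![1, 0]
    have h2 := h.1.1 ![0, 1]
    have h3 := h.1.2 ![1, 0]
    have h4 := h.1.2 ![0, 1]
    have h5 := fun hβ => h.2 hβ ![1, 1]
    cases b <;>
      simp [properDegenerations, law, mul_ofProducts, leftMul_ofProducts, rightMul_ofProducts]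
        at h1 h2 h3 h4 h5 ⊢ <;>
      grind
  | B3 =>
    have h1 := h.1 ![1, 0]
    have h2 := h.1 ![0, 1]
    have h3 := h.2 ![1, 0]
    have h4 := h.2 ![0, 1]
    cases b <;>
      simp [properDegenerations, law, leftMul_ofProducts, rightMul_ofProducts]
        at h1 h2 h3 h4 ⊢ <;>
      grind
  | B4 =>
    have h1 := h ![1, 0]
    have h2 := h ![0, 1]
    cases b <;>
      simp [properDegenerations, law, leftMul_ofProducts, rightMul_ofProducts]
        at h1 h2 ⊢ <;>
      grind
  | B5 =>
    have h1 := h.1 ![1, 0]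
    have h2 := h.1 ![0, 1]
    have h3 := h.2 ![1, 0]
    have h4 := h.2 ![0, 1]
    cases b <;>
      simp [properDegenerations, law, leftMul_ofProducts, rightMul_ofProducts]
        at h1 h2 h3 h4 ⊢ <;>
      grind

/-! ### Degenerations -/

section General

variable {n : ℕ} {K : Type*} [Field K]

theorem IsPolynomial.comp_act {F : StructureConstants n K → K} (hF : IsPolynomial F)
    (g : GL (Fin n) K) : IsPolynomial fun c => F (act g c) := by
  have h : ∀ t, IsPolynomial fun c => act g c t := fun t =>
    .sum Finset.univ fun l => (IsPolynomial.const ((g : Matrix (Fin n) (Fin n) K) t.2.2 l)).mul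
      (.mul_apply _ _ l)
  choose q hq using h
  obtain ⟨p, hp⟩ := hF
  refine ⟨MvPolynomial.bind₁ q p, fun c => ?_⟩
  change _ = F (act g c)
  rw [← hp, MvPolynomial.eval, MvPolynomial.eval₂Hom_bind₁]
  congr 2
  ext t
  exact hq t c

/-- The Zariski closure of an orbit is stable under the group. -/
theorem orbit_subset_zariskiClosure {c d : StructureConstants n K}
    (h : d ∈ zariskiClosure (orbit c)) : orbit d ⊆ zariskiClosure (orbit c) := by
  rintro _ ⟨g, rfl⟩ p hp
  obtain ⟨q, hq⟩ := IsPolynomial.comp_act (F := fun c => MvPolynomial.eval c p) ⟨p, fun _ => rfl⟩ g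
  refine (hq d).symm.trans (h q fun e he => (hq e).trans (hp _ ?_))
  exact orbit_trans he ⟨g, rfl⟩

end General

/-- A limit of points of an orbit along a continuous curve lies in its Zariski closure, since
polynomials are continuous. -/
theorem mem_zariskiClosure_of_continuous {n : ℕ} {c : StructureConstants n ℂ}
    (D : ℂ → StructureConstants n ℂ) (hD : Continuous D) (h : ∀ t ≠ 0, D t ∈ orbit c) :
    D 0 ∈ zariskiClosure (orbit c) := by
  intro p hp
  have hcont : Continuous fun t => MvPolynomial.aeval (D t) p :=
    (MvPolynomial.continuous_eval p).comp hD
  have h0 : (fun t => MvPolynomial.aeval (D t) p) = fun _ => 0 :=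
    hcont.ext_on (dense_compl_singleton (0 : ℂ)) continuous_const fun t ht => hp _ (h t ht)
  exact congrFun h0 0

theorem continuous_ofProducts {p q r s : ℂ → Fin 2 → ℂ} (hp : Continuous p) (hq : Continuous q)
    (hr : Continuous r) (hs : Continuous s) :
    Continuous fun t => ofProducts (p t) (q t) (r t) (s t) := by
  refine continuous_pi fun ⟨i, j, k⟩ => ?_
  fin_cases i <;> fin_cases j
  exacts [(continuous_apply k).comp hp, (continuous_apply k).comp hq,
    (continuous_apply k).comp hr, (continuous_apply k).comp hs]

theorem eq_ofProducts (c : StructureConstants 2 ℂ) :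
    c = ofProducts ![c (0, 0, 0), c (0, 0, 1)] ![c (0, 1, 0), c (0, 1, 1)]
      ![c (1, 0, 0), c (1, 0, 1)] ![c (1, 1, 0), c (1, 1, 1)] := by
  ext ⟨i, j, k⟩
  fin_cases i <;> fin_cases j <;> fin_cases k <;> rfl

/-- `ofProducts p q r s` lies in the orbit of `c` if it is the multiplication table of `c` in a
basis `f₁, f₂`. -/
theorem ofProducts_mem_orbit {c : StructureConstants 2 ℂ} {p q r s : Fin 2 → ℂ}
    (f₁ f₂ : Fin 2 → ℂ) (hdet : f₁ 0 * f₂ 1 - f₂ 0 * f₁ 1 ≠ 0)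
    (hp : mul c f₁ f₁ = p 0 • f₁ + p 1 • f₂) (hq : mul c f₁ f₂ = q 0 • f₁ + q 1 • f₂)
    (hr : mul c f₂ f₁ = r 0 • f₁ + r 1 • f₂) (hs : mul c f₂ f₂ = s 0 • f₁ + s 1 • f₂) :
    ofProducts p q r s ∈ orbit c := by
  have hM : ∀ v : Fin 2 → ℂ, !![f₁ 0, f₂ 0; f₁ 1, f₂ 1] *ᵥ v = v 0 • f₁ + v 1 • f₂ := by
    intro v
    ext k
    fin_cases k <;> simp [mulVec, dotProduct, Fin.sum_univ_two] <;> ring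
  have h₁ : !![f₁ 0, f₂ 0; f₁ 1, f₂ 1].col 0 = f₁ := by ext k; fin_cases k <;> rfl
  have h₂ : !![f₁ 0, f₂ 0; f₁ 1, f₂ 1].col 1 = f₂ := by ext k; fin_cases k <;> rfl
  refine mem_orbit_of_matrix !![f₁ 0, f₂ 0; f₁ 1, f₂ 1] (by rwa [det_fin_two_of]) fun i j => ?_
  rw [hM]
  fin_cases i <;> fin_cases j
  · simpa only [Fin.zero_eta, h₁] using! hp.symm
  · simpa only [Fin.zero_eta, Fin.mk_one, h₁, h₂] using! hq.symm
  · simpa only [Fin.zero_eta, Fin.mk_one, h₁, h₂] using! hr.symm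
  · simpa only [Fin.mk_one, h₂] using! hs.symm

theorem exists_smul_add_smul {f₁ f₂ : Fin 2 → ℂ} (hdet : f₁ 0 * f₂ 1 - f₂ 0 * f₁ 1 ≠ 0)
    (v : Fin 2 → ℂ) : ∃ p : Fin 2 → ℂ, v = p 0 • f₁ + p 1 • f₂ := by
  obtain ⟨e, he⟩ : ∃ e, e * (f₁ 0 * f₂ 1 - f₂ 0 * f₁ 1) = 1 := ⟨_, inv_mul_cancel₀ hdet⟩
  refine ⟨![e * (v 0 * f₂ 1 - v 1 * f₂ 0), e * (v 1 * f₁ 0 - v 0 * f₁ 1)], ?_⟩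
  ext k
  fin_cases k
  · simp
    linear_combination -v 0 * he
  · simp
    linear_combination -v 1 * he

/-- If `x` and `x · x` are independent, then the basis `x · x, x` gives a structure in the orbit
in which `e₂ · e₂ = e₁`. -/
theorem exists_mem_orbit_of_not_squaresParallel {c : StructureConstants 2 ℂ}
    (h : ¬ SquaresParallel c) : ∃ p q r, ofProducts p q r ![1, 0] ∈ orbit c := by
  obtain ⟨x, hx⟩ := not_forall.1 h
  have hdet : mul c x x 0 * x 1 - x 0 * mul c x x 1 ≠ 0 := fun h0 => hx (by linear_combination -h0)
  obtain ⟨p, hp⟩ := exists_smul_add_smul hdet (mul c (mul c x x) (mul c x x))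
  obtain ⟨q, hq⟩ := exists_smul_add_smul hdet (mul c (mul c x x) x)
  obtain ⟨r, hr⟩ := exists_smul_add_smul hdet (mul c x (mul c x x))
  exact ⟨p, q, r, ofProducts_mem_orbit _ _ hdet hp hq hr (by simp)⟩

theorem law_A1_mem_zariskiClosure (c : StructureConstants 2 ℂ) :
    law .A1 ∈ zariskiClosure (orbit c) := by
  have h := mem_zariskiClosure_of_continuous (c := c) (fun t => t • c) (by fun_prop) fun t ht => by
    refine mem_orbit_of_matrix (t • 1) (by simpa using ht) fun i j => ?_
    have hcol : ∀ i, (t • (1 : Matrix (Fin 2) (Fin 2) ℂ)).col i = t • Pi.single i 1 := by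
      intro i
      ext k
      simp [Matrix.one_apply, Pi.single_apply]
    rw [hcol, hcol, ← mulBilin_apply, map_smul, LinearMap.map_smul₂, mulBilin_apply,
      mul_single_single, smul_mulVec, one_mulVec]
    rfl
  convert h using 1
  rw [zero_smul, eq_ofProducts 0]
  rfl

/-- A degeneration read off from the multiplication tables of `c` in bases `f₁ t, f₂ t`, `t ≠ 0`,
that extend continuously to `t = 0`. -/
theorem mem_zariskiClosure_of_bases {c : StructureConstants 2 ℂ} {p q r s : ℂ → Fin 2 → ℂ}
    (f₁ f₂ : ℂ → Fin 2 → ℂ) (hp : Continuous p) (hq : Continuous q) (hr : Continuous r)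
    (hs : Continuous s)
    (h : ∀ t ≠ 0, f₁ t 0 * f₂ t 1 - f₂ t 0 * f₁ t 1 ≠ 0 ∧
      mul c (f₁ t) (f₁ t) = p t 0 • f₁ t + p t 1 • f₂ t ∧
      mul c (f₁ t) (f₂ t) = q t 0 • f₁ t + q t 1 • f₂ t ∧
      mul c (f₂ t) (f₁ t) = r t 0 • f₁ t + r t 1 • f₂ t ∧
      mul c (f₂ t) (f₂ t) = s t 0 • f₁ t + s t 1 • f₂ t) :
    ofProducts (p 0) (q 0) (r 0) (s 0) ∈ zariskiClosure (orbit c) :=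
  mem_zariskiClosure_of_continuous (fun t => ofProducts (p t) (q t) (r t) (s t))
    (continuous_ofProducts hp hq hr hs) fun t ht =>
      ofProducts_mem_orbit _ _ (h t ht).1 (h t ht).2.1 (h t ht).2.2.1 (h t ht).2.2.2.1
        (h t ht).2.2.2.2

/-- Every algebra with independent `x` and `x · x` degenerates to `A₅`: in the basis
`t² (x · x), t x` all products but the square of the second vector tend to `0` with `t`. -/
theorem law_A5_mem_zariskiClosure {c : StructureConstants 2 ℂ} (h : ¬ SquaresParallel c) :
    law .A5 ∈ zariskiClosure (orbit c) := by
  obtain ⟨p, q, r, h⟩ := exists_mem_orbit_of_not_squaresParallel h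
  rw [← orbit_eq h]
  have h' := mem_zariskiClosure_of_bases (c := ofProducts p q r ![1, 0])
    (p := fun t => ![t ^ 2 * p 0, t ^ 3 * p 1]) (q := fun t => ![t * q 0, t ^ 2 * q 1])
    (r := fun t => ![t * r 0, t ^ 2 * r 1]) (s := fun _ => ![1, 0])
    (fun t => ![t ^ 2, 0]) (fun t => ![0, t])
    (by fun_prop) (by fun_prop) (by fun_prop) (by fun_prop) fun t ht => by
      refine ⟨by simp [ht], ?_, ?_, ?_, ?_⟩ <;>
      · rw [mul_ofProducts]
        ext k
        fin_cases k <;> simp <;> ring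
  simpa [law] using h'

theorem law_A2_mem_zariskiClosure_A3 :
    law .A2 ∈ zariskiClosure (orbit (law .A3)) := by
  have h := mem_zariskiClosure_of_bases (c := law .A3)
    (p := fun t => ![1, 0]) (q := fun t => ![0, 0])
    (r := fun t => ![0, 0]) (s := fun t => ![0, t])
    (fun t => ![1, 0]) (fun t => ![0, t])
    (by fun_prop) (by fun_prop) (by fun_prop) (by fun_prop) fun t ht => by
      refine ⟨by simp [ht], ?_, ?_, ?_, ?_⟩ <;>
      · rw [law, mul_ofProducts]
        ext k
        fin_cases k <;> simp
  simpa [law] using h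

theorem law_A4_mem_zariskiClosure_A3 :
    law .A4 ∈ zariskiClosure (orbit (law .A3)) := by
  have h := mem_zariskiClosure_of_bases (c := law .A3)
    (p := fun t => ![0, t ^ 2]) (q := fun t => ![1, 0])
    (r := fun t => ![1, 0]) (s := fun t => ![0, 1])
    (fun t => ![t, -t]) (fun t => ![1, 1])
    (by fun_prop) (by fun_prop) (by fun_prop) (by fun_prop) fun t ht => by
      refine ⟨by simp [ht], ?_, ?_, ?_, ?_⟩ <;>
      · rw [law, mul_ofProducts]
        ext k
        fin_cases k <;> simp <;> grind
  simpa [law] using h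

theorem law_B1_mem_zariskiClosure_B3 :
    law (.B1 (-1)) ∈ zariskiClosure (orbit (law .B3)) := by
  have h := mem_zariskiClosure_of_bases (c := law .B3)
    (p := fun t => ![0, 0]) (q := fun t => ![0, 0])
    (r := fun t => ![-1, 0]) (s := fun t => ![t, -1])
    (fun t => ![t⁻¹, 0]) (fun t => ![0, 1])
    (by fun_prop) (by fun_prop) (by fun_prop) (by fun_prop) fun t ht => by
      refine ⟨by simp [ht], ?_, ?_, ?_, ?_⟩ <;>
      · rw [law, mul_ofProducts]
        ext k
        fin_cases k <;> simp <;> grind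
  simpa [law] using h

theorem law_B1_mem_zariskiClosure_B4 :
    law (.B1 (-2)) ∈ zariskiClosure (orbit (law .B4)) := by
  have h := mem_zariskiClosure_of_bases (c := law .B4)
    (p := fun t => ![0, t ^ 2]) (q := fun t => ![0, 0])
    (r := fun t => ![-1, 0]) (s := fun t => ![0, -2])
    (fun t => ![t, 0]) (fun t => ![0, 1])
    (by fun_prop) (by fun_prop) (by fun_prop) (by fun_prop) fun t ht => by
      refine ⟨by simp [ht], ?_, ?_, ?_, ?_⟩ <;>
      · rw [law, mul_ofProducts]
        ext k
        fin_cases k <;> simp <;> grind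
  simpa [law] using h

/-- In `B₄` the vector `f₂ = e₁ + e₂` satisfies `f₂ · f₂ = -f₂`, and `e₂` is an eigenvector of
`L_{f₂}` with eigenvalue `-2`; shrinking this eigenvector gives `B₂(-1)`. -/
theorem law_B2_mem_zariskiClosure_B4 :
    law (.B2 (-1) (neg_ne_zero.mpr one_ne_zero)) ∈ zariskiClosure (orbit (law .B4)) := by
  have h := mem_zariskiClosure_of_bases (c := law .B4)
    (p := fun t => ![-2 * t, 0]) (q := fun t => ![-1, -t])
    (r := fun t => ![-1 - 1, 0]) (s := fun t => ![0, -1])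
    (fun t => ![0, t]) (fun t => ![1, 1])
    (by fun_prop) (by fun_prop) (by fun_prop) (by fun_prop) fun t ht => by
      refine ⟨by simp [ht], ?_, ?_, ?_, ?_⟩ <;>
      · rw [law, mul_ofProducts]
        ext k
        fin_cases k <;> simp
        grind
  simpa [law] using h

theorem law_B2_mem_zariskiClosure_B5 :
    law (.B2 1 one_ne_zero) ∈ zariskiClosure (orbit (law .B5)) := by
  have h := mem_zariskiClosure_of_bases (c := law .B5)
    (p := fun t => ![0, 0]) (q := fun t => ![1, 0])
    (r := fun t => ![0, 0]) (s := fun t => ![t, 1])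
    (fun t => ![t⁻¹, 0]) (fun t => ![0, 1])
    (by fun_prop) (by fun_prop) (by fun_prop) (by fun_prop) fun t ht => by
      refine ⟨by simp [ht], ?_, ?_, ?_, ?_⟩ <;>
      · rw [law, mul_ofProducts]
        ext k
        fin_cases k <;> simp <;> grind
  simpa [law] using h

/-- The degenerations in the classification. Apart from the two general ones to `A₁` and `A₅`,
each is the limit at `t = 0` of the multiplication table in a basis that depends on `t`. -/
theorem mem_zariskiClosure_of_mem_properDegenerations {a b : Label}
    (hb : b ∈ properDegenerations a) : law b ∈ zariskiClosure (orbit (law a)) := by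
  have hA1 := law_A1_mem_zariskiClosure (law a)
  have hA5 := fun x (hx : x 0 * mul (law a) x x 1 - x 1 * mul (law a) x x 0 ≠ 0) =>
    law_A5_mem_zariskiClosure fun h => hx (h x)
  cases a with
  | A1 => exact hb.elim
  | A2 =>
    obtain rfl | rfl := hb
    · exact hA5 ![1, 1] (by simp [law, mul_ofProducts])
    · exact hA1
  | A3 =>
    obtain rfl | rfl | rfl | rfl := hb
    · exact law_A2_mem_zariskiClosure_A3
    · exact law_A4_mem_zariskiClosure_A3
    · exact hA5 ![1, 2] (by simp [law, mul_ofProducts]; norm_num)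
    · exact hA1
  | A4 =>
    obtain rfl | rfl := hb
    · exact hA5 ![1, 1] (by simp [law, mul_ofProducts])
    · exact hA1
  | A5 =>
    obtain rfl := hb
    exact hA1
  | B1 α =>
    obtain ⟨hα, rfl⟩ | rfl := hb
    · exact hA5 ![1, 1] (by simp [law, mul_ofProducts]; grind)
    · exact hA1
  | B2 β hβ =>
    obtain ⟨hβ, rfl⟩ | rfl := hb
    · exact hA5 ![1, 1] (by simp [law, mul_ofProducts]; grind)
    · exact hA1
  | B3 =>
    obtain rfl | rfl | rfl := hb
    · exact hA5 ![0, 1] (by simp [law, mul_ofProducts])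
    · exact law_B1_mem_zariskiClosure_B3
    · exact hA1
  | B4 =>
    obtain rfl | rfl | rfl | rfl := hb
    · exact law_B1_mem_zariskiClosure_B4
    · exact law_B2_mem_zariskiClosure_B4
    · exact hA5 ![1, 0] (by simp [law, mul_ofProducts])
    · exact hA1
  | B5 =>
    obtain rfl | rfl | rfl := hb
    · exact hA5 ![0, 1] (by simp [law, mul_ofProducts])
    · exact law_B2_mem_zariskiClosure_B5
    · exact hA1

/-! ### Classification of the structures -/

theorem exists_eq_vec_two (v : Fin 2 → ℂ) : ∃ a b, v = ![a, b] :=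
  ⟨v 0, v 1, by ext k; fin_cases k <;> rfl⟩

/-- A structure that is not commutative has a basis with `e₁ · e₂ - e₂ · e₁ = e₁`: the commutator
is `[x, y] = (x ∧ y) w` with `w ≠ 0`, and `e₁ = w` with any `e₂` such that `w ∧ e₂ = 1` will do. -/
theorem exists_mem_orbit_of_not_isCommutative {c : StructureConstants 2 ℂ}
    (h : ¬ IsCommutative c) :
    ∃ p r s, ofProducts p (r + ![1, 0]) r s ∈ orbit c := by
  have hw : ∀ x y, mul c x y - mul c y x = (x 0 * y 1 - x 1 * y 0) •
      (fun k => c (0, 1, k) - c (1, 0, k)) := by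
    intro x y
    ext k
    simp [mul, Fin.sum_univ_two]
    ring
  set w : Fin 2 → ℂ := fun k => c (0, 1, k) - c (1, 0, k)
  obtain ⟨v, hv⟩ : ∃ v : Fin 2 → ℂ, w 0 * v 1 - w 1 * v 0 = 1 := by
    by_cases h0 : w 0 = 0
    · have h1 : w 1 ≠ 0 := fun h1 => h fun x y => sub_eq_zero.1 <| by
        rw [hw, show w = 0 by ext k; fin_cases k <;> assumption, smul_zero]
      exact ⟨![-(w 1)⁻¹, 0], by simp [h1]⟩
    · exact ⟨![0, (w 0)⁻¹], by simp [h0]⟩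
  have hdet : w 0 * v 1 - v 0 * w 1 ≠ 0 := by
    rw [mul_comm (v 0), hv]
    exact one_ne_zero
  obtain ⟨p, hp⟩ := exists_smul_add_smul hdet (mul c w w)
  obtain ⟨r, hr⟩ := exists_smul_add_smul hdet (mul c v w)
  obtain ⟨s, hs⟩ := exists_smul_add_smul hdet (mul c v v)
  refine ⟨p, r, s, ofProducts_mem_orbit _ _ hdet hp ?_ hr hs⟩
  rw [sub_eq_iff_eq_add.1 (hw w v), hv, hr]
  ext k
  simp
  ring

/-- A noncommutative pre-Lie structure, in a basis with `[e₁, e₂] = e₁`. The pre-Lie identity says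
`[L₁, L₂] = L₁`, so that `L₁` is nilpotent, which leaves three cases: `L₁ = 0` (`B₁`, `B₃`),
`L₁ ≠ 0` with `L₁ e₁ = 0` (`B₂`, `B₅`), and `L₁ e₁ ≠ 0` (`B₄`). -/
theorem exists_law_mem_orbit_of_not_isCommutative {m : StructureConstants 2 ℂ} (hc : IsPreLie m)
    (h : ¬ IsCommutative m) : ∃ l, law l ∈ orbit m := by
  obtain ⟨p, r, s, hmem⟩ := exists_mem_orbit_of_not_isCommutative h
  obtain ⟨a, b, rfl⟩ := exists_eq_vec_two p
  obtain ⟨c, d, rfl⟩ := exists_eq_vec_two r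
  obtain ⟨e, f, rfl⟩ := exists_eq_vec_two s
  have hpl := hc.of_mem_orbit hmem
  suffices H : ∃ l, law l ∈ orbit (ofProducts ![a, b] (![c, d] + ![1, 0]) ![c, d] ![e, f]) from
    H.imp fun _ h => orbit_trans hmem h
  have h1 := hpl ![1, 0] ![0, 1] ![1, 0]
  have h2 := hpl ![1, 0] ![0, 1] ![0, 1]
  simp [mul_ofProducts] at h1 h2
  obtain ⟨⟨h10, h11⟩, h20, h21⟩ := And.intro h1 h2
  -- `L₁` has trace and determinant zero.
  have htr : a = -d := by grind
  have hdet : b * (c + 1) = -d ^ 2 := by grind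
  clear hc h h1 h2 hmem hpl
  by_cases hp1 : b = 0
  · have hr1 : d = 0 := by grind
    have hp0 : a = 0 := by grind
    -- The last coefficient of `[L₁, L₂] = L₁`.
    have hf : c + 1 = 0 ∨ f = c + 1 := by grind
    by_cases hr0 : c + 1 = 0
    · by_cases hs1 : f = -1
      · by_cases hs0 : e = 0
        · refine ⟨.B1 (-1), ofProducts_mem_orbit ![1, 0] ![0, 1] (by simp) ?_ ?_ ?_ ?_⟩ <;>
          · rw [mul_ofProducts]
            ext k
            fin_cases k <;> simp <;> grind
        · refine ⟨.B3, ofProducts_mem_orbit ![e, 0] ![0, 1] (by simpa) ?_ ?_ ?_ ?_⟩ <;>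
          · rw [mul_ofProducts]
            ext k
            fin_cases k <;> simp <;> grind
      · -- The multiple of `e₁` added to `e₂` removes the `e₁`-part of `e₂ · e₂`.
        refine ⟨.B1 f, ofProducts_mem_orbit ![1, 0] ![e / (1 + f), 1] (by simp)
          ?_ ?_ ?_ ?_⟩ <;>
        · rw [mul_ofProducts]
          ext k
          fin_cases k <;> simp <;> grind
    · have hs1 := hf.resolve_left hr0
      by_cases hr : c = 0
      · by_cases hs0 : e = 0
        · refine ⟨.B2 1 one_ne_zero, ofProducts_mem_orbit ![1, 0] ![0, 1] (by simp)
            ?_ ?_ ?_ ?_⟩ <;>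
          · rw [mul_ofProducts]
            ext k
            fin_cases k <;> simp <;> grind
        · refine ⟨.B5, ofProducts_mem_orbit ![e, 0] ![0, 1] (by simpa) ?_ ?_ ?_ ?_⟩ <;>
          · rw [mul_ofProducts]
            ext k
            fin_cases k <;> simp <;> grind
      · -- The multiple of `e₁` added to `e₂` removes the `e₁`-part of `e₂ · e₂`.
        refine ⟨.B2 (c + 1) hr0, ofProducts_mem_orbit ![1, 0] ![-e / c, 1] (by simp)
          ?_ ?_ ?_ ?_⟩ <;>
        · rw [mul_ofProducts]
          ext k
          fin_cases k <;> simp <;> grind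
  · -- Since `[e₁, e₁ · e₁] = b e₁`, the vectors `f₁ = κ e₁` and `f₂ = f₁ · f₁` satisfy
    -- `[f₁, f₂] = f₁` if `κ² b = 1`, and then `f₂ = (e₁ · e₁) / b`.
    obtain ⟨κ, hκ⟩ := IsAlgClosed.exists_pow_nat_eq b⁻¹ two_pos
    have hκ0 : κ ≠ 0 := by
      rintro rfl
      simp [eq_comm, hp1] at hκ
    have hκ' : κ ^ 2 * b = 1 := by rw [hκ, inv_mul_cancel₀ hp1]
    refine ⟨.B4, ofProducts_mem_orbit ![κ, 0] ![a / b, 1] (by simpa) ?_ ?_ ?_ ?_⟩ <;>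
    · rw [mul_ofProducts]
      ext k
      fin_cases k <;> simp <;> grind

/-- A commutative pre-Lie structure in which all squares `x · x` are parallel to `x` is zero. -/
theorem eq_A1_of_squaresParallel {c : StructureConstants 2 ℂ} (hc : IsPreLie c)
    (h : IsCommutative c) (hsq : SquaresParallel c) : c = law .A1 := by
  obtain ⟨a, b, d, e, f, g, rfl⟩ : ∃ a b d e f g,
      c = ofProducts ![a, b] ![d, e] ![d, e] ![f, g] := by
    have h0 := h ![1, 0] ![0, 1]
    rw [eq_ofProducts c] at h0 ⊢
    simp [mul_ofProducts] at h0
    exact ⟨_, _, _, _, _, _, by rw [h0.1, h0.2]⟩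
  have h1 := hc ![1, 0] ![0, 1] ![1, 0]
  have h2 := hc ![1, 0] ![0, 1] ![0, 1]
  have h3 := hsq ![1, 0]
  have h4 := hsq ![0, 1]
  have h5 := hsq ![1, 1]
  have h6 := hsq ![1, -1]
  simp [mul_ofProducts, funext_iff, Fin.forall_fin_two] at h1 h2 h3 h4 h5 h6
  obtain ⟨rfl, rfl, rfl, rfl, rfl, rfl⟩ : a = 0 ∧ b = 0 ∧ d = 0 ∧ e = 0 ∧ f = 0 ∧ g = 0 := by
    grind
  rfl

/-- A commutative pre-Lie structure is associative. If it is generated by one element, it is the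
quotient of `t ℂ[t]` by `t (t - x) (t - y)` for complex `x`, `y`, and these roots decide: `A₃` for
different nonzero roots, `A₄` for a double nonzero root, `A₂` for one zero root, `A₅` if both are
zero. -/
theorem exists_law_mem_orbit_of_isCommutative {c : StructureConstants 2 ℂ} (hc : IsPreLie c)
    (h : IsCommutative c) : ∃ l, law l ∈ orbit c := by
  by_cases hsq : SquaresParallel c
  · exact ⟨.A1, eq_A1_of_squaresParallel hc h hsq ▸ self_mem_orbit _⟩
  obtain ⟨p, q, r, hmem⟩ := exists_mem_orbit_of_not_squaresParallel hsq
  obtain ⟨a, b, rfl⟩ := exists_eq_vec_two p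
  obtain ⟨d, e, rfl⟩ := exists_eq_vec_two q
  obtain ⟨f, g, rfl⟩ := exists_eq_vec_two r
  have hpl := hc.of_mem_orbit hmem
  have hcomm := IsCommutative.passesToClosure.of_mem_orbit h hmem
  suffices H : ∃ l, law l ∈ orbit (ofProducts ![a, b] ![d, e] ![f, g] ![1, 0]) from
    H.imp fun _ h => orbit_trans hmem h
  have hqr := hcomm ![1, 0] ![0, 1]
  have hass := hpl ![1, 0] ![0, 1] ![0, 1]
  simp [mul_ofProducts] at hqr hass
  obtain ⟨rfl, rfl⟩ := hqr
  obtain ⟨hp0, hp1⟩ := hass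
  clear hc h hsq hmem hpl hcomm
  obtain ⟨δ, hδ⟩ := IsAlgClosed.exists_pow_nat_eq (d ^ 2 + 4 * e) two_pos
  obtain ⟨x, y, hxy, hxy'⟩ : ∃ x y : ℂ, d = x + y ∧ e = -(x * y) :=
    ⟨(d + δ) / 2, (d - δ) / 2, by ring, by linear_combination -hδ / 4⟩
  have hp0' : a = (x + y) ^ 2 - x * y := by grind
  have hp1' : b = -(x + y) * (x * y) := by grind
  by_cases hx : x = 0
  · by_cases hy : y = 0
    · refine ⟨.A5, ofProducts_mem_orbit ![1, 0] ![0, 1] (by simp) ?_ ?_ ?_ ?_⟩ <;>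
      · rw [mul_ofProducts]
        ext k
        fin_cases k <;> simp <;> grind
    · refine ⟨.A2, ofProducts_mem_orbit ![1 / y ^ 2, 0] ![1, -y] (by simpa) ?_ ?_ ?_ ?_⟩ <;>
      · rw [mul_ofProducts]
        ext k
        fin_cases k <;> simp <;> grind
  · by_cases hy : y = 0
    · refine ⟨.A2, ofProducts_mem_orbit ![1 / x ^ 2, 0] ![1, -x] (by simpa) ?_ ?_ ?_ ?_⟩ <;>
      · rw [mul_ofProducts]
        ext k
        fin_cases k <;> simp <;> grind
    · by_cases hne : x = y
      · -- In terms of `t = e₂` and `t² = e₁`: the nilpotent `t² - x t` and the unit.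
        refine ⟨.A4, ofProducts_mem_orbit ![1, -x] ![-1 / x ^ 2, 2 / x] (by simp; grind)
          ?_ ?_ ?_ ?_⟩ <;>
        · rw [mul_ofProducts]
          ext k
          fin_cases k <;> simp <;> grind
      · -- The idempotents `u (t² - y t)` and `v (t² - x t)`, where `t = e₂`, `t² = e₁`: each has
        -- the value `1` at one of the roots `x`, `y` and `0` at the other.
        obtain ⟨u, hu⟩ : ∃ u, u * (x * (x - y)) = 1 :=
          ⟨_, inv_mul_cancel₀ (mul_ne_zero hx (sub_ne_zero.2 hne))⟩
        obtain ⟨v, hv⟩ : ∃ v, v * (y * (y - x)) = 1 :=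
          ⟨_, inv_mul_cancel₀ (mul_ne_zero hy (sub_ne_zero.2 (Ne.symm hne)))⟩
        clear hp0 hp1 hδ
        subst hp0' hp1' hxy hxy'
        refine ⟨.A3, ofProducts_mem_orbit ![u, -y * u] ![v, -x * v] (by simp; grind)
          ?_ ?_ ?_ ?_⟩ <;>
        · rw [mul_ofProducts]
          ext k
          fin_cases k <;> simp <;> grind

theorem exists_law_mem_orbit {c : StructureConstants 2 ℂ} (hc : IsPreLie c) :
    ∃ a, law a ∈ orbit c := by
  by_cases h : IsCommutative c
  · exact exists_law_mem_orbit_of_isCommutative hc h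
  · exact exists_law_mem_orbit_of_not_isCommutative hc h

theorem isPreLie_law (a : Label) : IsPreLie (law a) := by
  intro x y z
  cases a <;>
  · simp only [law, mul_ofProducts]
    ext k
    fin_cases k <;> simp <;> ring

/-! ### Orbit closures -/

/-- The equations attached to `b` fail on `law a`, so that the two orbits are different. -/
theorem law_notMem_orbit {a b : Label} (hb : b ∈ properDegenerations a) :
    law b ∉ orbit (law a) := by
  intro h
  have h' := eq_or_mem_properDegenerations
    ((closureEquations_passesToClosure b).of_mem_orbit (closureEquations_self b) (orbit_symm h))
  cases a <;> cases b <;> simp [properDegenerations] at hb h'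

theorem degeneratesExactlyTo_properDegenerations (a : Label) :
    DegeneratesExactlyTo a (properDegenerations a) := by
  have hsub : ∀ {b}, law b ∈ zariskiClosure (orbit (law a)) →
      b = a ∨ b ∈ properDegenerations a := fun h =>
    eq_or_mem_properDegenerations
      (closureEquations_passesToClosure a _ (closureEquations_self a) _ h)
  refine ⟨Set.ext fun c => ⟨fun ⟨hc, hcl⟩ => ?_, ?_⟩, fun b => ⟨fun ⟨⟨_, hb⟩, hne⟩ => ?_, fun hb =>
    ⟨⟨isPreLie_law b, mem_zariskiClosure_of_mem_properDegenerations hb⟩, law_notMem_orbit hb⟩⟩⟩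
  · obtain ⟨b, hb⟩ := exists_law_mem_orbit hc
    rcases hsub (orbit_subset_zariskiClosure hcl hb) with rfl | hmem
    · exact Or.inl (orbit_symm hb)
    · exact Or.inr (Set.mem_biUnion hmem (orbit_symm hb))
  · rintro (hc | hc)
    · exact ⟨(isPreLie_law a).of_mem_orbit hc, subset_zariskiClosure _ hc⟩
    · obtain ⟨b, hb, hcb⟩ := Set.mem_iUnion₂.1 hc
      exact ⟨(isPreLie_law b).of_mem_orbit hcb,
        orbit_subset_zariskiClosure (mem_zariskiClosure_of_mem_properDegenerations hb) hcb⟩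
  · rcases hsub hb with rfl | hmem
    · exact absurd (self_mem_orbit _) hne
    · exact hmem

end PreLieDegeneration

open PreLieDegeneration PreLieDegeneration.Label in
theorem mainTheorem1 :
    DegeneratesExactlyTo A3 {A2, A4, A5, A1} ∧
    DegeneratesExactlyTo B4 {B1 (-2), B2 (-1) (neg_ne_zero.mpr one_ne_zero), A5, A1} ∧
    DegeneratesExactlyTo A2 {A5, A1} ∧
    DegeneratesExactlyTo A4 {A5, A1} ∧
    (∀ α : ℂ, α ≠ -1 → DegeneratesExactlyTo (B1 α) {A5, A1}) ∧
    (∀ (β : ℂ) (hβ : β ≠ 0), β ≠ 1 → DegeneratesExactlyTo (B2 β hβ) {A5, A1}) ∧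
    DegeneratesExactlyTo B3 {A5, B1 (-1), A1} ∧
    DegeneratesExactlyTo B5 {A5, B2 1 one_ne_zero, A1} ∧
    DegeneratesExactlyTo A5 {A1} ∧
    DegeneratesExactlyTo (B1 (-1)) {A1} ∧
    DegeneratesExactlyTo (B2 1 one_ne_zero) {A1} ∧
    DegeneratesExactlyTo A1 ∅ := by
  have h := degeneratesExactlyTo_properDegenerations
  refine ⟨h A3, h B4, h A2, h A4, fun α hα => ?_, fun β hβ hβ' => ?_, h B3, h B5, h A5, ?_, ?_,
    h A1⟩
  · convert h (B1 α)
    ext b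
    simp [properDegenerations, hα]
  · convert h (B2 β hβ)
    ext b
    simp [properDegenerations, hβ']
  · convert h (B1 (-1))
    ext b
    simp [properDegenerations]
  · convert h (B2 1 one_ne_zero)
    ext b
    simp [properDegenerations]
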